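/- Let $q=2^m$, let $\theta$ be a nontrivial automorphism of odd order of the field $\mathbb{F}_q$, and let $P$ be a Suzuki $2$-group of type $\mathcal{A}(m,\theta)$, that is, $P$ is isomorphic to the group of all pairs $(\alpha,\beta)$ with $\alpha,\beta\in\mathbb{F}_q$ and multiplication $$(\alpha_1,\beta_1)(\alpha_2,\beta_2)=(\alpha_1+\alpha_2,\ \beta_1+\beta_2+\alpha_1\theta(\alpha_2)).$$ Fix such an isomorphism and regard it as an identification. Then: 1. $Z(P)=\{(0,\beta):\beta\in\mathbb{F}_q\}$ has order $q$. Hence $\alpha$ and $\beta$ identify $P/Z(P)$ and $Z(P)$, respectively, with the additive group of $\mathbb{F}_q$. 2. The group $\mathbb{F}_q^\times$ is cyclic of order $q-1$, the group $\mathrm{Aut}(\mathbb{F}_q)$ of field automorphisms is cyclic of order $m$, and with respect to the natural action there is an isomorphism $$\mathrm{Aut}(P)/O_2(\mathrm{Aut}(P))\;\cong\;\mathbb{F}_q^\times\rtimes \mathrm{Aut}(\mathbb{F}_q)\;\cong\; C_{q-1}\rtimes C_m$$ such that every automorphism of $P$ whose image is $(a,\sigma)$ acts on $P/Z(P)$ by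 $\alpha\mapsto a\,\sigma(\alpha)$ and on $Z(P)$ by $\beta\mapsto a\,\theta(a)\,\sigma(\beta)$. In particular, every automorphism of $P$ whose image is $(c,1)$ with $c$ a generator of $\mathbb{F}_q^\times$ acts as a Singer cycle both on $P/Z(P)$ and on $Z(P)$ (that is, it induces an automorphism of order $q-1$ whose powers permute the non-identity elements transitively), and $C_m$ acts through field automorphisms of $\mathbb{F}_q$. 3. $\mathrm{Aut}(P)/O_2(\mathrm{Aut}(P))$ acts faithfully on $Z(P)$ and on $P/Z(P)$: the kernel of the action of $\mathrm{Aut}(P)$ on $Z(P)$ and the kernel of its action on $P/Z(P)$ are both equal to $O_2(\mathrm{Aut}(P))$. Here $O_2(G)$ is the largest normal $2$-subgroup of the finite group $G$. -/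

import Mathlib

/-- The underlying set of the group `A(m, θ)`: pairs `(α, β)` of elements of a field `F`
with `2 ^ m` elements, where `θ` is an automorphism of `F`. -/
@[ext]
structure SuzukiA {F : Type*} [Field F] (θ : RingAut F) where
  /-- the coordinate `α` -/
  fst : F
  /-- the coordinate `β` -/
  snd : F

namespace SuzukiA

variable {F : Type*} [Field F] {θ : RingAut F}

/-- `(α₁, β₁) (α₂, β₂) = (α₁ + α₂, β₁ + β₂ + α₁ θ(α₂))`. -/
instance : Mul (SuzukiA θ) := ⟨fun x y => ⟨x.fst + y.fst, x.snd + y.snd + x.fst * θ y.fst⟩⟩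

instance : One (SuzukiA θ) := ⟨⟨0, 0⟩⟩

instance : Inv (SuzukiA θ) := ⟨fun x => ⟨-x.fst, -x.snd + x.fst * θ x.fst⟩⟩

@[simp] theorem mul_fst (x y : SuzukiA θ) : (x * y).fst = x.fst + y.fst := rfl

@[simp] theorem mul_snd (x y : SuzukiA θ) :
    (x * y).snd = x.snd + y.snd + x.fst * θ y.fst := rfl

@[simp] theorem one_fst : (1 : SuzukiA θ).fst = 0 := rfl

@[simp] theorem one_snd : (1 : SuzukiA θ).snd = 0 := rfl

@[simp] theorem inv_fst (x : SuzukiA θ) : (x⁻¹).fst = -x.fst := rfl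

@[simp] theorem inv_snd (x : SuzukiA θ) : (x⁻¹).snd = -x.snd + x.fst * θ x.fst := rfl

instance : Group (SuzukiA θ) :=
  Group.ofLeftAxioms
    (fun x y z => by
      ext
      · simp [add_assoc]
      · simp only [mul_fst, mul_snd, map_add]; ring)
    (fun x => by ext <;> simp)
    (fun x => by ext <;> simp)

end SuzukiA

/-- `O_p(G)`, the subgroup generated by all normal `p`-subgroups of `G`
(for finite `G`, the largest normal `p`-subgroup). -/
def pCore (p : ℕ) (G : Type*) [Group G] : Subgroup G :=
  sSup {N : Subgroup G | N.Normal ∧ IsPGroup p N}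

instance pCore_normal (p : ℕ) (G : Type*) [Group G] : (pCore p G).Normal :=
  Subgroup.sSup_normal _ fun _ h => h.1

/-- The action of `Aut(P)` on `Z(P)` by restriction. -/
def autCenter (P : Type*) [Group P] : MulAut P →* MulAut (Subgroup.center P) where
  toFun g := Subgroup.centerCongr g
  map_one' := rfl
  map_mul' _ _ := rfl

/-- The induced action of `Aut(P)` on `P / Z(P)`. -/
def autModCenter (P : Type*) [Group P] : MulAut P →* MulAut (P ⧸ Subgroup.center P) where
  toFun g := QuotientGroup.congr (Subgroup.center P) (Subgroup.center P) g
    (Subgroup.characteristic_iff_map_eq.mp inferInstance g)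
  map_one' := by
    ext x
    obtain ⟨x, rfl⟩ := QuotientGroup.mk_surjective x
    rfl
  map_mul' _ _ := by
    ext x
    obtain ⟨x, rfl⟩ := QuotientGroup.mk_surjective x
    rfl

/-- A Singer cycle on a finite elementary abelian group `V`: an automorphism of order `|V| - 1`
whose powers permute the non-identity elements of `V` transitively. -/
def IsSingerCycle {V : Type*} [Group V] (τ : MulAut V) : Prop :=
  orderOf τ = Nat.card V - 1 ∧ ∀ x y : V, x ≠ 1 → y ≠ 1 → ∃ k : ℤ, (τ ^ k) x = y

/-- The natural action of the field automorphisms of `F` on the multiplicative group of `F`. -/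
def fieldAutOnUnits (F : Type*) [Field F] : RingAut F →* MulAut Fˣ where
  toFun σ := Units.mapEquiv (σ : F ≃* F)
  map_one' := rfl
  map_mul' _ _ := rfl

/-! An automorphism `g` of `A(m, θ)` induces additive maps `A` on `P / Z(P)` and `B` on `Z(P)`.
Since `(α, 0)² = (0, α θ(α))`, they satisfy `B (x θ(x)) = A x · θ (A x)`. Expanding `A` and `B` as
combinations of field automorphisms turns this into the vanishing of a quadratic form in the
conjugates of `x`. Comparing coefficients leaves at most one automorphism in the expansion of `A`,
so `A x = a σ(x)` (`RingAut.exists_eq_mul_of_map_mul_map`). As `θ` has odd order, `x ↦ x θ(x)` is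
bijective, which forces `B x = a θ(a) σ(x)`.

This gives a homomorphism `toSemilinear` from the automorphism group to `Fˣ ⋊ RingAut F`, surjective
because every pair `(a, σ)` lifts by these same formulas. Its kernel has exponent dividing 2, and
its target has no nontrivial normal 2-subgroup, so the kernel is exactly `O_2`. Faithfulness on
`Z(P)` is the implication `a θ(a) = 1 → a = 1`. -/

/-! ### Additive maps and quadratic forms expanded in field automorphisms. -/

theorem RingAut.eq_zero_of_sum_mul_eq_zero {F : Type*} [Field F] [Fintype (RingAut F)]
    (c : RingAut F → F) (h : ∀ x : F, ∑ σ, c σ * σ x = 0) (σ : RingAut F) : c σ = 0 := by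
  have hinj : Function.Injective (fun σ : RingAut F => ((σ : F →+* F) : F →* F)) := by
    intro σ τ hστ
    ext x
    exact DFunLike.congr_fun hστ x
  refine Fintype.linearIndependent_iff.1 ((linearIndependent_monoidHom F F).comp _ hinj) c ?_ σ
  funext x
  simpa using h x

/-- The field automorphisms of a finite field of characteristic `p` are the automorphisms of the
algebra over the prime field. -/
def RingAut.equivZModAlgAut (p : ℕ) (F : Type*) [Field F] [Algebra (ZMod p) F] :
    RingAut F ≃* Gal(F/ZMod p) where
  toFun σ := AlgEquiv.ofRingEquiv (f := σ) fun r => by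
    have : (σ : F →+* F).comp (algebraMap (ZMod p) F) = algebraMap (ZMod p) F :=
      Subsingleton.elim _ _
    exact DFunLike.congr_fun this r
  invFun σ := σ.toRingEquiv
  left_inv _ := rfl
  right_inv _ := rfl
  map_mul' _ _ := rfl

@[simp] theorem RingAut.equivZModAlgAut_apply (p : ℕ) {F : Type*} [Field F] [Algebra (ZMod p) F]
    (σ : RingAut F) (x : F) : RingAut.equivZModAlgAut p F σ x = σ x := rfl

theorem RingAut.card_eq_finrank (p : ℕ) [Fact p.Prime] (F : Type*) [Field F] [Finite F]
    [Algebra (ZMod p) F] : Nat.card (RingAut F) = Module.finrank (ZMod p) F := by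
  rw [Nat.card_congr (RingAut.equivZModAlgAut p F).toEquiv, IsGalois.card_aut_eq_finrank]

theorem RingAut.isCyclic (p : ℕ) [Fact p.Prime] (F : Type*) [Field F] [Finite F]
    [CharP F p] : IsCyclic (RingAut F) := by
  let _ := ZMod.algebra F p
  exact (RingAut.equivZModAlgAut p F).isCyclic.2 inferInstance

theorem RingAut.card_of_card_eq_pow (p : ℕ) [Fact p.Prime] (F : Type*) [Field F] [Finite F]
    [CharP F p] {m : ℕ} (h : Nat.card F = p ^ m) : Nat.card (RingAut F) = m := by
  let _ := ZMod.algebra F p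
  rw [RingAut.card_eq_finrank p]
  have := Module.natCard_eq_pow_finrank (K := ZMod p) (V := F)
  rw [h, Nat.card_zmod] at this
  exact (Nat.pow_right_injective (Fact.out : p.Prime).two_le this).symm

/-- Field automorphisms are independent over `F` by Dedekind, and their number is the `F`-dimension
of the space of `ZMod p`-linear endomorphisms of `F`, so they form a basis of it. -/
theorem AddMonoidHom.exists_eq_sum_ringAut (p : ℕ) [Fact p.Prime] {F : Type*} [Field F] [Finite F]
    [CharP F p] [Fintype (RingAut F)] (A : F →+ F) :
    ∃ a : RingAut F → F, ∀ x, A x = ∑ σ, a σ * σ x := by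
  let _ := ZMod.algebra F p
  let v : RingAut F → (F →ₗ[ZMod p] F) := fun σ =>
    (RingAut.equivZModAlgAut p F σ).toAlgHom.toLinearMap
  have hv : LinearIndependent F v := by
    rw [Fintype.linearIndependent_iff]
    intro g hg
    refine RingAut.eq_zero_of_sum_mul_eq_zero g fun x => ?_
    have := DFunLike.congr_fun hg x
    simpa [v] using this
  have hspan := hv.span_eq_top_of_card_eq_finrank' (by
    rw [Module.finrank_linearMap_self, ← RingAut.card_eq_finrank, Nat.card_eq_fintype_card])
  have hA : A.toZModLinearMap p ∈ Submodule.span F (Set.range v) := hspan ▸ Submodule.mem_top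
  obtain ⟨a, ha⟩ := (Submodule.mem_span_range_iff_exists_fun F).1 hA
  refine ⟨a, fun x => ?_⟩
  have := DFunLike.congr_fun ha x
  simpa [v] using this.symm

/-- Polarizing and applying Dedekind independence in each variable gives symmetry. The off-diagonal
terms then cancel in pairs, leaving `∑ M σ σ · σ(x²) = 0`; every element is a square, so
independence applies once more. -/
theorem RingAut.symm_and_diag_of_quadratic_eq_zero {F : Type*} [Field F] [Finite F]
    [CharP F 2] [Fintype (RingAut F)] (M : RingAut F → RingAut F → F)
    (h : ∀ x : F, ∑ σ, ∑ τ, M σ τ * (σ x * τ x) = 0) :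
    (∀ σ τ, M σ τ = M τ σ) ∧ ∀ σ, M σ σ = 0 := by
  classical
  have hsymm : ∀ σ τ, M σ τ = M τ σ := by
    have hpol : ∀ x y : F, ∑ σ, (∑ τ, (M σ τ + M τ σ) * τ y) * σ x = 0 := by
      intro x y
      have e : ∑ σ, (∑ τ, (M σ τ + M τ σ) * τ y) * σ x =
          (∑ σ, ∑ τ, M σ τ * (σ (x + y) * τ (x + y))) - (∑ σ, ∑ τ, M σ τ * (σ x * τ x)) -
            ∑ σ, ∑ τ, M σ τ * (σ y * τ y) := by
        have e2 : ∑ σ, ∑ τ, M τ σ * τ y * σ x = ∑ σ, ∑ τ, M σ τ * σ y * τ x :=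
          Finset.sum_comm
        simp only [map_add, Finset.sum_mul, add_mul, Finset.sum_add_distrib]
        rw [e2]
        simp only [← Finset.sum_add_distrib, ← Finset.sum_sub_distrib]
        refine Finset.sum_congr rfl fun σ _ => Finset.sum_congr rfl fun τ _ => ?_
        ring
      rw [e, h, h, h]; simp
    intro σ τ
    have h1 : ∀ y, ∑ τ, (M σ τ + M τ σ) * τ y = 0 := fun y =>
      RingAut.eq_zero_of_sum_mul_eq_zero _ (fun x => hpol x y) σ
    exact CharTwo.add_eq_zero.1 (RingAut.eq_zero_of_sum_mul_eq_zero _ h1 τ)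
  refine ⟨hsymm, fun σ => ?_⟩
  have hdiag : ∀ x : F, ∑ σ, M σ σ * σ x = 0 := by
    have key : ∀ x : F, ∑ σ, M σ σ * (σ x * σ x) = 0 := by
      intro x
      have h0 := h x
      rw [← Finset.univ.sum_product' Finset.univ (fun σ τ => M σ τ * (σ x * τ x)),
        ← Finset.sum_filter_add_sum_filter_not _ (fun q : RingAut F × RingAut F => q.1 = q.2)] at h0
      rw [Finset.sum_involution (s := Finset.filter (fun q : RingAut F × RingAut F => ¬ q.1 = q.2) _)
        (fun q _ => q.swap) ?_ ?_ ?_ ?_, add_zero] at h0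
      · rw [← h0]
        refine Finset.sum_bij (fun σ _ => (σ, σ)) ?_ ?_ ?_ ?_ <;> simp
      · rintro ⟨σ, τ⟩ _
        simp only [Prod.swap, hsymm τ σ, mul_comm (τ x)]
        exact CharTwo.add_self_eq_zero _
      · rintro ⟨σ, τ⟩ hq _
        simp only [Finset.mem_filter] at hq
        simp only [Prod.swap, ne_eq, Prod.mk.injEq, not_and]
        exact fun he => absurd he.symm hq.2
      · rintro ⟨σ, τ⟩ hq
        simp only [Finset.mem_filter] at hq
        simpa [eq_comm] using hq.2
      · rintro ⟨σ, τ⟩ _; rfl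
    intro x
    obtain ⟨y, rfl⟩ := FiniteField.isSquare_of_char_two (CharP.ringChar_of_prime_eq_zero
      Nat.prime_two (CharTwo.two_eq_zero (R := F))) x
    simpa using key y
  exact RingAut.eq_zero_of_sum_mul_eq_zero _ hdiag σ

/-! ### The map `x ↦ x θ(x)` and the additive maps compatible with it. -/

namespace RingAut

variable {F : Type*} [Field F] [CharP F 2]

/-- Here `θ` inverts `u`, so its odd power `θ ^ orderOf θ = 1` does too; thus `u² = 1`, and `u = 1`
in characteristic 2. -/
theorem eq_one_of_mul_map_eq_one {θ : RingAut F} (hodd : Odd (orderOf θ)) {u : F}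
    (hu : u * θ u = 1) : u = 1 := by
  have h1 : θ u = u⁻¹ := eq_inv_of_mul_eq_one_right hu
  have h2 : (θ ^ 2) u = u := by
    rw [pow_two, RingAut.mul_apply, h1, map_inv₀, h1, inv_inv]
  obtain ⟨k, hk⟩ := hodd
  have h3 : ∀ n : ℕ, ((θ ^ 2) ^ n) u = u := by
    intro n
    induction n with
    | zero => simp
    | succ n ih => rw [pow_succ, RingAut.mul_apply, h2, ih]
  have h4 : (θ ^ orderOf θ) u = u⁻¹ := by
    rw [hk, pow_succ', pow_mul, RingAut.mul_apply, h3, h1]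
  rw [pow_orderOf_eq_one, RingAut.one_apply] at h4
  have hu0 : u ≠ 0 := left_ne_zero_of_mul_eq_one hu
  have h5 : u * u = 1 := by
    nth_rewrite 2 [h4]
    exact mul_inv_cancel₀ hu0
  rw [← sub_eq_zero]
  have h6 : (u - 1) * (u - 1) = 0 := by
    linear_combination h5 + (1 - u) * CharTwo.two_eq_zero (R := F)
  exact mul_self_eq_zero.1 h6

theorem mul_map_injective {θ : RingAut F} (hodd : Odd (orderOf θ)) :
    Function.Injective fun x : F => x * θ x := by
  intro x y hxy
  simp only at hxy
  by_cases hy : y = 0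
  · subst hy
    simpa using hxy
  · have : x / y * θ (x / y) = 1 := by
      have hy' : θ y ≠ 0 := (map_ne_zero θ).2 hy
      rw [map_div₀]
      field_simp
      exact hxy
    exact (div_eq_one_iff_eq hy).1 (eq_one_of_mul_map_eq_one hodd this)

variable [Finite F]

theorem commute (σ τ : RingAut F) : σ * τ = τ * σ := by
  have := RingAut.isCyclic 2 F
  let _ := IsCyclic.commGroup (α := RingAut F)
  exact mul_comm σ τ

theorem mul_map_surjective {θ : RingAut F} (hodd : Odd (orderOf θ)) :
    Function.Surjective fun x : F => x * θ x :=
  Finite.surjective_of_injective (mul_map_injective hodd)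

theorem exists_eq_mul_of_map_mul_map {θ : RingAut F} (hθ : θ ≠ 1) (hodd : Odd (orderOf θ))
    (A B : F →+ F) (h : ∀ x, B (x * θ x) = A x * θ (A x)) :
    ∃ (a : F) (σ : RingAut F), ∀ x, A x = a * σ x := by
  classical
  have : Finite (RingAut F) := DFunLike.finite _
  have := Fintype.ofFinite (RingAut F)
  obtain ⟨a, ha⟩ := A.exists_eq_sum_ringAut 2
  obtain ⟨b, hb⟩ := B.exists_eq_sum_ringAut 2
  -- These are the coefficients of `θ ∘ A`.
  let c : RingAut F → F := fun τ => θ (a (θ⁻¹ * τ))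
  have hc : ∀ τ, c (θ * τ) = θ (a τ) := fun τ => by simp [c]
  obtain ⟨hsymm, hdiag⟩ := symm_and_diag_of_quadratic_eq_zero
    (fun σ τ => a σ * c τ - if τ = θ * σ then b σ else 0) (by
      intro x
      have e1 : ∑ σ, ∑ τ, a σ * c τ * (σ x * τ x) = A x * θ (A x) := by
        have : θ (A x) = ∑ τ, c τ * τ x := by
          rw [ha, map_sum, ← Equiv.sum_comp (Equiv.mulLeft θ) (fun τ => c τ * τ x)]
          simp [hc, RingAut.mul_apply]
        rw [this, ha, Finset.sum_mul_sum]
        exact Finset.sum_congr rfl fun σ _ => Finset.sum_congr rfl fun τ _ => by ring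
      have e2 : ∑ σ, ∑ τ, (if τ = θ * σ then b σ else 0) * (σ x * τ x) = B (x * θ x) := by
        rw [hb]
        refine Finset.sum_congr rfl fun σ _ => ?_
        simp only [ite_mul, zero_mul, Finset.sum_ite_eq', Finset.mem_univ, if_true]
        rw [commute, RingAut.mul_apply, map_mul]
      simp only [sub_mul, Finset.sum_sub_distrib]
      rw [e1, e2, h, sub_self])
  have hne : ∀ σ : RingAut F, σ ≠ θ * σ := fun σ hσ => hθ (by simpa using hσ.symm)
  have hdiag' : ∀ σ, a σ * c σ = 0 := fun σ => by simpa [hne] using hdiag σ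
  -- The coefficient at `(σ, θρ)` is `a σ · θ (a ρ) ≠ 0`. The one at `(θρ, σ)` must equal it, but
  -- since `c σ = 0` it can be nonzero only through the `B`-term, which requires `σ = θ²ρ`. By
  -- symmetry `ρ = θ²σ` as well, so `θ⁴ = 1`, against odd order.
  have hsupp : ∀ σ ρ, a σ ≠ 0 → a ρ ≠ 0 → ρ ≠ σ → σ = θ * (θ * ρ) := by
    intro σ ρ hσ hρ hρσ
    by_contra hcon
    have hcσ : c σ = 0 := (mul_eq_zero.1 (hdiag' σ)).resolve_left hσ
    have := hsymm σ (θ * ρ)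
    rw [if_neg (by simpa using hρσ), if_neg hcon, hcσ, hc] at this
    simp [hσ, hρ] at this
  by_cases h0 : ∃ σ, a σ ≠ 0
  · obtain ⟨σ, hσ⟩ := h0
    refine ⟨a σ, σ, fun x => ?_⟩
    rw [ha, Finset.sum_eq_single σ _ (by simp)]
    intro ρ _ hρσ
    by_contra hρ
    have hρ' : a ρ ≠ 0 := left_ne_zero_of_mul hρ
    have h1 := hsupp σ ρ hσ hρ' hρσ
    have h2 := hsupp ρ σ hρ' hσ hρσ.symm
    rw [h2] at h1
    have h4 : θ ^ 4 = 1 := by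
      have : θ ^ 4 * σ = σ := by simpa [pow_succ, mul_assoc] using h1.symm
      simpa using this
    have h5 : orderOf θ ∣ 1 := by
      have : Nat.Coprime (orderOf θ) (2 ^ 2) := hodd.coprime_two_right.pow_right 2
      exact this.dvd_of_dvd_mul_left (by simpa using orderOf_dvd_of_pow_eq_one h4)
    exact hθ (orderOf_eq_one_iff.1 (Nat.dvd_one.1 h5))
  · push Not at h0
    -- The case `A = 0`, where `σ` is arbitrary.
    exact ⟨0, 1, fun x => by simp [ha, h0]⟩

end RingAut

/-! ### Automorphisms of `A(m, θ)` as semilinear maps. -/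

theorem fieldAutOnUnits_apply {F : Type*} [Field F] (σ : RingAut F) (a : Fˣ) :
    (fieldAutOnUnits F σ a : F) = σ a := rfl

theorem SemidirectProduct.ext_of_semilinear {F : Type*} [Field F]
    {p q : Fˣ ⋊[fieldAutOnUnits F] RingAut F}
    (h : ∀ x : F, (p.left : F) * p.right x = q.left * q.right x) : p = q := by
  have hl : p.left = q.left := Units.ext (by simpa using h 1)
  refine SemidirectProduct.ext hl ?_
  ext x
  have := h x
  rw [hl] at this
  exact mul_left_cancel₀ q.left.ne_zero this

namespace SuzukiA

variable {F : Type*} [Field F] {θ : RingAut F}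

theorem mem_center_iff [CharP F 2] (hθ : θ ≠ 1) {x : SuzukiA θ} :
    x ∈ Subgroup.center (SuzukiA θ) ↔ x.fst = 0 := by
  rw [Subgroup.mem_center_iff]
  constructor
  · intro h
    have key : ∀ y : F, x.fst * θ y = y * θ x.fst := fun y => by
      have := congrArg SuzukiA.snd (h ⟨y, 0⟩)
      simp only [mul_snd, zero_add, add_zero] at this
      exact (add_left_cancel this).symm
    -- Once `x.fst` is fixed by `θ`, a nonzero value could be cancelled from `key`, making `θ`
    -- trivial.
    have h1 : x.fst = θ x.fst := by simpa using key 1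
    by_contra h0
    refine hθ (RingEquiv.ext fun y => ?_)
    have := key y
    rw [← h1, mul_comm y] at this
    exact mul_left_cancel₀ h0 this
  · intro h y
    ext <;> simp [h, add_comm]

theorem fst_apply (hθ : θ ≠ 1) [CharP F 2] (g : MulAut (SuzukiA θ)) (x : SuzukiA θ) :
    (g x).fst = (g ⟨x.fst, 0⟩).fst := by
  have hx : x = ⟨x.fst, 0⟩ * ⟨0, x.snd⟩ := by ext <;> simp
  have h0 : (g ⟨0, x.snd⟩).fst = 0 := by
    rw [← mem_center_iff hθ]
    exact (Subgroup.centerCongr g ⟨⟨0, x.snd⟩, (mem_center_iff hθ).2 rfl⟩).2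
  conv_lhs => rw [hx]
  rw [map_mul, mul_fst, h0, add_zero]

theorem exists_semilinear [Finite F] [CharP F 2] (hθ : θ ≠ 1) (hodd : Odd (orderOf θ))
    (g : MulAut (SuzukiA θ)) :
    ∃ p : Fˣ ⋊[fieldAutOnUnits F] RingAut F,
      (∀ x, (g x).fst = p.left * p.right x.fst) ∧
      ∀ x ∈ Subgroup.center (SuzukiA θ), (g x).snd = p.left * θ p.left * p.right x.snd := by
  have hcen : ∀ β, (g ⟨0, β⟩).fst = 0 := fun β => by
    rw [fst_apply hθ]
    change (g 1).fst = 0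
    simp
  let A : F →+ F := AddMonoidHom.mk' (fun α => (g ⟨α, 0⟩).fst) fun α β => by
    rw [← mul_fst, ← map_mul, fst_apply hθ g (_ * _)]
    simp
  let B : F →+ F := AddMonoidHom.mk' (fun β => (g ⟨0, β⟩).snd) fun α β => by
    have : (⟨0, α + β⟩ : SuzukiA θ) = ⟨0, α⟩ * ⟨0, β⟩ := by ext <;> simp
    rw [this, map_mul, mul_snd, hcen, zero_mul, add_zero]
  have hAB : ∀ α, B (α * θ α) = A α * θ (A α) := fun α => by
    have : (⟨0, α * θ α⟩ : SuzukiA θ) = ⟨α, 0⟩ * ⟨α, 0⟩ := by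
      ext <;> simp [CharTwo.add_self_eq_zero]
    change (g ⟨0, α * θ α⟩).snd = _
    rw [this, map_mul, mul_snd, CharTwo.add_self_eq_zero, zero_add]
    rfl
  obtain ⟨a, σ, hA⟩ := RingAut.exists_eq_mul_of_map_mul_map hθ hodd A B hAB
  have ha : a ≠ 0 := by
    rintro rfl
    obtain ⟨x, hx⟩ := g.surjective ⟨1, 0⟩
    have h1 : A x.fst = 1 := by
      change (g ⟨x.fst, 0⟩).fst = 1
      rw [← fst_apply hθ, hx]
    rw [hA, zero_mul] at h1
    exact zero_ne_one h1
  refine ⟨⟨Units.mk0 a ha, σ⟩, fun x => ?_, fun x hx => ?_⟩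
  · rw [fst_apply hθ]
    exact hA x.fst
  -- Every central element is the square of some `(α, 0)`, so `A` determines `B`.
  · obtain ⟨α, hα⟩ := RingAut.mul_map_surjective hodd x.snd
    have hx' : x = ⟨0, α * θ α⟩ := SuzukiA.ext ((mem_center_iff hθ).1 hx) hα.symm
    rw [hx']
    change B (α * θ α) = a * θ a * σ (α * θ α)
    have hc : θ (σ α) = σ (θ α) := DFunLike.congr_fun (RingAut.commute θ σ) α
    rw [hAB, hA, map_mul, map_mul, hc]
    ring

/-- The semilinear map induced on the first coordinate by an automorphism of `A(m, θ)`. -/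
noncomputable def toSemilinear [Finite F] [CharP F 2] (hθ : θ ≠ 1) (hodd : Odd (orderOf θ)) :
    MulAut (SuzukiA θ) →* Fˣ ⋊[fieldAutOnUnits F] RingAut F :=
  MonoidHom.mk' (fun g => (exists_semilinear hθ hodd g).choose) fun g h => by
    -- A pair is determined by its semilinear map, so the choices are forced and multiplicativity
    -- can be tested pointwise.
    refine SemidirectProduct.ext_of_semilinear fun x => ?_
    have h1 := (exists_semilinear hθ hodd (g * h)).choose_spec.1 ⟨x, 0⟩
    have h2 := (exists_semilinear hθ hodd g).choose_spec.1 (h ⟨x, 0⟩)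
    have h3 := (exists_semilinear hθ hodd h).choose_spec.1 ⟨x, 0⟩
    rw [← h1, MulAut.mul_apply, h2, h3]
    simp [fieldAutOnUnits_apply, mul_assoc]

section

variable [Finite F] [CharP F 2] (hθ : θ ≠ 1) (hodd : Odd (orderOf θ))

theorem apply_fst (g : MulAut (SuzukiA θ)) (x : SuzukiA θ) :
    (g x).fst = (toSemilinear hθ hodd g).left * (toSemilinear hθ hodd g).right x.fst :=
  (exists_semilinear hθ hodd g).choose_spec.1 x

theorem apply_snd (g : MulAut (SuzukiA θ)) {x : SuzukiA θ}
    (hx : x ∈ Subgroup.center (SuzukiA θ)) :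
    (g x).snd = (toSemilinear hθ hodd g).left * θ (toSemilinear hθ hodd g).left *
      (toSemilinear hθ hodd g).right x.snd :=
  (exists_semilinear hθ hodd g).choose_spec.2 x hx

theorem toSemilinear_surjective : Function.Surjective (toSemilinear hθ hodd) := by
  intro p
  let φ : SuzukiA θ →* SuzukiA θ := MonoidHom.mk'
    (fun x => ⟨p.left * p.right x.fst, p.left * θ p.left * p.right x.snd⟩) fun x y => by
      have hc : θ (p.right y.fst) = p.right (θ y.fst) :=
        DFunLike.congr_fun (RingAut.commute θ p.right) y.fst
      ext
      · simp [mul_add]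
      · simp only [mul_snd, map_add, map_mul, hc]
        ring
  have hφ : Function.Bijective φ := by
    have hθ0 : θ (p.left : F) ≠ 0 := (map_ne_zero θ).2 p.left.ne_zero
    constructor
    · intro x y hxy
      have h1 : (p.left : F) * p.right x.fst = p.left * p.right y.fst := congrArg fst hxy
      have h2 : p.left * θ p.left * p.right x.snd = p.left * θ p.left * p.right y.snd :=
        congrArg snd hxy
      ext
      · exact p.right.injective (mul_left_cancel₀ p.left.ne_zero h1)
      · exact p.right.injective (mul_left_cancel₀ (mul_ne_zero p.left.ne_zero hθ0) h2)
    · intro x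
      refine ⟨⟨p.right.symm (p.left⁻¹ * x.fst), p.right.symm ((p.left * θ p.left)⁻¹ * x.snd)⟩, ?_⟩
      ext
      · simp [φ]
      · change _ * _ * p.right (p.right.symm _) = _
        rw [RingEquiv.apply_symm_apply, mul_inv_cancel_left₀ (mul_ne_zero p.left.ne_zero hθ0)]
  refine ⟨MulEquiv.ofBijective φ hφ, SemidirectProduct.ext_of_semilinear fun x => ?_⟩
  rw [← apply_fst hθ hodd _ ⟨x, 0⟩]
  rfl

/-- The element `z = x⁻¹ g(x)` is central, fixed by `g`, and satisfies `z² = 1`, so `g²(x) = x z² =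
x`. -/
theorem sq_eq_one_of_toSemilinear_eq_one {g : MulAut (SuzukiA θ)}
    (hg : toSemilinear hθ hodd g = 1) : g ^ 2 = 1 := by
  have h1 : ∀ x, (g x).fst = x.fst := fun x => by rw [apply_fst hθ hodd, hg]; simp
  have h2 : ∀ x ∈ Subgroup.center (SuzukiA θ), (g x).snd = x.snd := fun x hx => by
    rw [apply_snd hθ hodd _ hx, hg]; simp
  ext1 x
  have hz : (x⁻¹ * g x).fst = 0 := by simp [h1]
  have hgz : g (x⁻¹ * g x) = x⁻¹ * g x :=
    SuzukiA.ext (h1 _) (h2 _ ((mem_center_iff hθ).2 hz))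
  have hzz : (x⁻¹ * g x) * (x⁻¹ * g x) = 1 := by
    ext
    · simp [hz]
    · rw [mul_snd, hz, zero_mul, add_zero, CharTwo.add_self_eq_zero]; rfl
  have hgx : g x = x * (x⁻¹ * g x) := by group
  calc (g ^ 2) x = g (g x) := by rw [pow_two, MulAut.mul_apply]
    _ = g (x * (x⁻¹ * g x)) := by rw [← hgx]
    _ = x * ((x⁻¹ * g x) * (x⁻¹ * g x)) := by
      rw [map_mul, hgz]; nth_rewrite 1 [hgx]; rw [mul_assoc]
    _ = x := by rw [hzz, mul_one]

end

end SuzukiA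

/-! ### Normal 2-subgroups of the semilinear group, and Singer cycles. -/

/-- Frobenius is injective, so `Fˣ` has no 2-torsion and `N` meets it trivially. Commutators of `N`
with `Fˣ` lie in this intersection, so the field automorphism part of each element of `N` fixes
every unit; hence `N` lies in `Fˣ` and is trivial. -/
theorem SemidirectProduct.eq_bot_of_normal_of_isPGroup_two {F : Type*} [Field F] [Finite F]
    [CharP F 2] (N : Subgroup (Fˣ ⋊[fieldAutOnUnits F] RingAut F)) [hN : N.Normal]
    (hp : IsPGroup 2 N) : N = ⊥ := by
  have hinl : ∀ b : Fˣ, SemidirectProduct.inl b ∈ N → b = 1 := by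
    intro b hb
    obtain ⟨k, hk⟩ := hp ⟨_, hb⟩
    have h1 : (SemidirectProduct.inl (b ^ 2 ^ k) : Fˣ ⋊[fieldAutOnUnits F] RingAut F) = 1 := by
      rw [map_pow]
      exact congrArg Subtype.val hk
    have h2 : b ^ 2 ^ k = 1 := SemidirectProduct.inl_injective (by rw [h1, map_one])
    refine Units.ext (iterateFrobenius_inj F 2 k ?_)
    simpa [iterateFrobenius_def] using congrArg Units.val h2
  rw [Subgroup.eq_bot_iff_forall]
  intro p hpN
  have hr : p.right = 1 := by
    ext x
    by_cases hx : x = 0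
    · simp [hx]
    · let b := Units.mk0 x hx
      have hmem : p * (SemidirectProduct.inl b * p⁻¹ * (SemidirectProduct.inl b)⁻¹) ∈ N :=
        N.mul_mem hpN (hN.conj_mem _ (N.inv_mem hpN) _)
      have heq : p * (SemidirectProduct.inl b * p⁻¹ * (SemidirectProduct.inl b)⁻¹) =
          SemidirectProduct.inl (fieldAutOnUnits F p.right b * b⁻¹) := by
        refine SemidirectProduct.ext (Units.ext ?_) (by simp)
        have hl := p.left.ne_zero
        simp
        field_simp
      rw [heq] at hmem
      have := mul_inv_eq_one.1 (hinl _ hmem)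
      exact congrArg Units.val this
  have hpl : p = SemidirectProduct.inl p.left := SemidirectProduct.ext rfl hr
  rw [hpl] at hpN ⊢
  rw [hinl _ hpN, map_one]

/-- In the coordinate `h`, `τ` is multiplication by a generator of `Fˣ`. A bijection sending `1` to
`0` suffices; additivity of `h` plays no role. -/
theorem IsSingerCycle.of_equiv {V F : Type*} [Group V] [Field F] [Finite F] (h : V ≃ F)
    (h1 : h 1 = 0) (τ : MulAut V) (c : Fˣ) (hc : ∀ y : Fˣ, y ∈ Subgroup.zpowers c)
    (hτ : ∀ v, h (τ v) = c * h v) : IsSingerCycle τ := by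
  have hpow : ∀ (k : ℕ) v, h ((τ ^ k) v) = ((c ^ k : Fˣ) : F) * h v := by
    intro k
    induction k with
    | zero => simp
    | succ k ih => intro v; rw [pow_succ, MulAut.mul_apply, ih, hτ, pow_succ, Units.val_mul, mul_assoc]
  constructor
  · rw [Nat.card_congr h, ← Nat.card_units, ← orderOf_eq_card_of_forall_mem_zpowers hc]
    refine orderOf_eq_orderOf_iff.2 fun n => ⟨fun hn => ?_, fun hn => ?_⟩
    · have := hpow n (h.symm 1)
      rw [hn] at this
      exact Units.ext (by simpa using this.symm)
    · ext v
      exact h.injective (by rw [hpow, hn]; simp)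
  · intro x y hx hy
    have hx' : h x ≠ 0 := fun h0 => hx (h.injective (h0.trans h1.symm))
    have hy' : h y ≠ 0 := fun h0 => hy (h.injective (h0.trans h1.symm))
    obtain ⟨k, hk⟩ := (Submonoid.mem_powers_iff _ _).1
      (mem_powers_iff_mem_zpowers.2 (hc (Units.mk0 (h y) hy' / Units.mk0 (h x) hx')))
    refine ⟨k, h.injective ?_⟩
    rw [zpow_natCast, hpow, hk]
    simp [hx']

/-! ### Transfer to `P` and identification of `O_2`. -/

theorem mainTheorem7 {F : Type*} [Field F] {m : ℕ} (hF : Nat.card F = 2 ^ m)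
    (θ : RingAut F) (hθ : θ ≠ 1) (hodd : Odd (orderOf θ))
    {P : Type*} [Group P] (f : P ≃* SuzukiA θ) :
    -- `Z(P) = {(0, β)}` has order `q`
    (Nat.card (Subgroup.center P) = 2 ^ m ∧
      ∀ x : P, x ∈ Subgroup.center P ↔ (f x).fst = 0) ∧
    -- `Fˣ` is cyclic of order `q - 1`, the group of field automorphisms is cyclic of order `m`
    (IsCyclic Fˣ ∧ Nat.card Fˣ = 2 ^ m - 1 ∧ IsCyclic (RingAut F) ∧ Nat.card (RingAut F) = m) ∧
    (∃ e : MulAut P ⧸ pCore 2 (MulAut P) ≃* Fˣ ⋊[fieldAutOnUnits F] RingAut F,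
      -- an automorphism with image `(a, σ)` acts on `P / Z(P)` as `α ↦ a σ(α)` and on `Z(P)` as
      -- `β ↦ a θ(a) σ(β)`
      (∀ (g : MulAut P) (a : Fˣ) (σ : RingAut F),
        e (QuotientGroup.mk g) = ⟨a, σ⟩ →
          (∀ x : P, (f (g x)).fst = a * σ (f x).fst) ∧
          (∀ z ∈ Subgroup.center P, (f (g z)).snd = a * θ a * σ (f z).snd)) ∧
      -- generators of `C_{q-1}` are Singer cycles on `P / Z(P)` and on `Z(P)`
      (∀ (g : MulAut P) (c : Fˣ), (∀ y : Fˣ, y ∈ Subgroup.zpowers c) →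
        e (QuotientGroup.mk g) = SemidirectProduct.inl c →
          IsSingerCycle (autModCenter P g) ∧ IsSingerCycle (autCenter P g))) ∧
    -- `Aut(P) / O_2(Aut(P))` acts on `Z(P)` and on `P / Z(P)`, faithfully
    (autCenter P).ker = pCore 2 (MulAut P) ∧
    (autModCenter P).ker = pCore 2 (MulAut P) := by
  have : Finite F := Nat.finite_of_card_ne_zero (by rw [hF]; positivity)
  have : CharP F 2 := by
    have := Fintype.ofFinite F
    exact charP_of_card_eq_prime_pow (Nat.card_eq_fintype_card (α := F) ▸ hF)
  have hcen : ∀ x : P, x ∈ Subgroup.center P ↔ (f x).fst = 0 := fun x => by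
    rw [← SuzukiA.mem_center_iff hθ]
    exact ⟨fun hx => (Subgroup.centerCongr f ⟨x, hx⟩).2,
      fun hx => f.symm_apply_apply x ▸ (Subgroup.centerCongr f.symm ⟨f x, hx⟩).2⟩
  let eZ : Subgroup.center P ≃ F :=
    { toFun := fun z => (f z).snd
      invFun := fun β => ⟨f.symm ⟨0, β⟩, (hcen _).2 (by simp)⟩
      left_inv := fun z => Subtype.ext (f.injective
        (SuzukiA.ext (by simp [(hcen _).1 z.2]) (by simp)))
      right_inv := fun β => by simp }
  have hquot : ∀ x y : P, (x : P ⧸ Subgroup.center P) = y ↔ (f x).fst = (f y).fst := fun x y => by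
    rw [QuotientGroup.eq, hcen, map_mul, map_inv, SuzukiA.mul_fst, SuzukiA.inv_fst,
      neg_add_eq_zero]
  let eQ : P ⧸ Subgroup.center P ≃ F := Equiv.ofBijective
    (Quotient.lift (fun x : P => (f x).fst) fun x y hxy => (hquot x y).1 (Quotient.sound hxy))
    ⟨fun x y => by
      obtain ⟨x, rfl⟩ := QuotientGroup.mk_surjective x
      obtain ⟨y, rfl⟩ := QuotientGroup.mk_surjective y
      exact (hquot x y).2, fun α => ⟨(f.symm ⟨α, 0⟩ : P), by
        change (f (f.symm ⟨α, 0⟩)).fst = α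
        simp⟩⟩
  let Φ : MulAut P →* Fˣ ⋊[fieldAutOnUnits F] RingAut F :=
    (SuzukiA.toSemilinear hθ hodd).comp (MulAut.congr f).toMonoidHom
  have hΦ : Function.Surjective Φ :=
    (SuzukiA.toSemilinear_surjective hθ hodd).comp (MulAut.congr f).surjective
  have hfst : ∀ (g : MulAut P) (x : P), (f (g x)).fst = (Φ g).left * (Φ g).right (f x).fst :=
    fun g x => by simpa [Φ] using SuzukiA.apply_fst hθ hodd (MulAut.congr f g) (f x)
  have hsnd : ∀ (g : MulAut P), ∀ z ∈ Subgroup.center P,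
      (f (g z)).snd = (Φ g).left * θ (Φ g).left * (Φ g).right (f z).snd := fun g z hz => by
    simpa [Φ] using SuzukiA.apply_snd hθ hodd (MulAut.congr f g) (x := f z)
      ((SuzukiA.mem_center_iff hθ).2 ((hcen z).1 hz))
  have hker : Φ.ker = pCore 2 (MulAut P) := by
    refine le_antisymm (le_sSup ⟨inferInstance, fun g => ⟨1, Subtype.ext ?_⟩⟩) (sSup_le ?_)
    · have := SuzukiA.sq_eq_one_of_toSemilinear_eq_one hθ hodd
        (g := MulAut.congr f g) g.2
      exact (MulAut.congr f).injective (by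
        rw [pow_one, Subgroup.coe_pow, map_pow, this]; exact (map_one (MulAut.congr f)).symm)
    · rintro N ⟨hN, hp⟩
      have := hN.map Φ hΦ
      have := SemidirectProduct.eq_bot_of_normal_of_isPGroup_two (N.map Φ) (hp.map Φ)
      exact (Subgroup.map_eq_bot_iff N).1 this
  refine ⟨⟨by rw [Nat.card_congr eZ, hF], hcen⟩,
    ⟨inferInstance, by rw [Nat.card_units, hF], RingAut.isCyclic 2 F,
      RingAut.card_of_card_eq_pow 2 F hF⟩,
    ⟨(QuotientGroup.quotientMulEquivOfEq hker.symm).trans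
      (QuotientGroup.quotientKerEquivOfSurjective Φ hΦ), ?_, ?_⟩, ?_, ?_⟩
  · intro g a σ hg
    replace hg : Φ g = ⟨a, σ⟩ := hg
    constructor
    · intro x; rw [hfst, hg]
    · intro z hz; rw [hsnd g z hz, hg]
  · intro g c hc hg
    replace hg : Φ g = SemidirectProduct.inl c := hg
    constructor
    · refine IsSingerCycle.of_equiv eQ (by change (f 1).fst = 0; simp) _ c hc fun v => ?_
      obtain ⟨x, rfl⟩ := QuotientGroup.mk_surjective v
      change (f (g x)).fst = c * (f x).fst
      rw [hfst, hg]; simp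
    -- The multiplier on `Z(P)` is `Q c = c θ(c)`; it is again a generator because the endomorphism
    -- `Q` of `Fˣ` is surjective.
    · let Q : Fˣ →* Fˣ := MonoidHom.id Fˣ * (fieldAutOnUnits F θ).toMonoidHom
      have hQ : ∀ a : Fˣ, (Q a : F) = a * θ a := fun _ => rfl
      refine IsSingerCycle.of_equiv eZ (by change (f 1).snd = 0; simp) _ (Q c) (fun y => ?_)
        fun z => ?_
      · obtain ⟨x, hx⟩ := RingAut.mul_map_surjective hodd (y : F)
        have hx0 : x ≠ 0 := by
          rintro rfl
          exact y.ne_zero (by simpa using hx.symm)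
        obtain ⟨k, hk⟩ := Subgroup.mem_zpowers_iff.1 (hc (Units.mk0 x hx0))
        refine Subgroup.mem_zpowers_iff.2 ⟨k, Units.ext ?_⟩
        rw [← map_zpow, hk, hQ]
        exact hx
      · change (f (g z)).snd = Q c * (f z).snd
        rw [hsnd g z z.2, hg, hQ]; simp
  · rw [← hker]
    ext g
    have h1 : g ∈ (autCenter P).ker ↔ ∀ z ∈ Subgroup.center P, g z = z := by
      rw [MonoidHom.mem_ker, MulEquiv.ext_iff, Subtype.forall]
      exact forall₂_congr fun z hz => Subtype.ext_iff
    rw [h1, MonoidHom.mem_ker]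
    constructor
    · intro h
      have h2 : ∀ β, (Φ g).left * θ (Φ g).left * (Φ g).right β = β := fun β => by
        have hz : f.symm ⟨0, β⟩ ∈ Subgroup.center P := (hcen _).2 (by simp)
        have := hsnd g _ hz
        rw [h _ hz] at this
        simpa using this.symm
      -- At `β = 1` the field automorphism disappears, leaving `a θ(a) = 1`.
      have h3 := RingAut.eq_one_of_mul_map_eq_one hodd (by simpa using h2 1)
      refine SemidirectProduct.ext_of_semilinear fun x => ?_
      have := h2 x
      rw [h3] at this
      simpa [h3] using this
    · intro h z hz
      refine f.injective (SuzukiA.ext ?_ ?_)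
      · rw [hfst, h]; simp
      · rw [hsnd g z hz, h]; simp
  · rw [← hker]
    ext g
    have h1 : g ∈ (autModCenter P).ker ↔ ∀ x : P, (f (g x)).fst = (f x).fst := by
      rw [MonoidHom.mem_ker, MulEquiv.ext_iff, (QuotientGroup.mk_surjective).forall]
      exact forall_congr' fun x => hquot (g x) x
    rw [h1, MonoidHom.mem_ker]
    constructor
    · intro h
      refine SemidirectProduct.ext_of_semilinear fun x => ?_
      have := hfst g (f.symm ⟨x, 0⟩)
      rw [h] at this
      simpa using this.symm
    · intro h x
      rw [hfst, h]; simp
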